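/- **Theorem.** Let $M$ be a Garside monoid, i.e. a finitely generated, left and right cancellative, atomic monoid such that $(M,\le_L)$ and $(M,\le_R)$ are lattices, where $a\le_L b$ (resp. $a\le_R b$) means $ac=b$ (resp. $ca=b$) for some $c\in M$, and which has a Garside element, i.e. an element whose set of left divisors equals its set of right divisors and generates $M$. (Atomic: $M$ is generated by its atoms, the elements $a\neq 1$ such that $a=bc$ forces $b=1$ or $c=1$, and for each $a\in M$ the lengths of the expressions of $a$ as a product of atoms are bounded.) Fix a Garside element $\Delta$ of $M$, and let $G\supseteq M$ be the group of fractions of $M$ (a Garside group). For $g,h\in G$ write $g\le_L h$ if $gc=h$ for some $c\in M$, and put $$\inf(g)=\max\{r\in\mathbb Z:\Delta^r\le_L g\},\qquad \sup(g)=\min\{s\in\mathbb Z: g\le_L\Delta^s\}.$$ The super summit set of $g$ is the set of conjugates $h$ of $g$ in $G$ such that $\inf(h)$ is the maximum of $\inf$ over the conjugacy class of $g$ and $\sup(h)$ is the minimum of $\sup$ over the conjugacy class of $g$. Let $\mathcal D=\{b\in M: b\le_L\Delta\}$ be the set of simple elements, let $|g|_{\mathcal D}$ be the shortest length of a word in the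 alphabet $\mathcal D\cup\mathcal D^{-1}$ representing $g$, and let $t_{\mathcal D}(g)=\lim_{n\to\infty}|g^n|_{\mathcal D}/n$ be the corresponding translation number. If $g\in G$ lies in its own super summit set, then for every integer $n\ge 1$ $$|g|_{\mathcal D}-2<\frac{|g^n|_{\mathcal D}}{n}\le|g|_{\mathcal D}.$$ In particular, the limit $t_{\mathcal D}(g)$ exists and $|g|_{\mathcal D}-2\le t_{\mathcal D}(g)\le|g|_{\mathcal D}$. -/

import Mathlib

open Filter Topology
open scoped Pointwise

namespace Garside

section Monoid

variable {M : Type*} [Monoid M]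

/-- `a ≠ 1`, and `a = b * c` forces `b = 1` or `c = 1`. -/
def IsMonoidAtom (a : M) : Prop :=
  a ≠ 1 ∧ ∀ b c : M, a = b * c → b = 1 ∨ c = 1

/-- `‖a‖`: the supremum of the lengths of all expressions of `a` as a product of atoms. -/
noncomputable def atomNorm (a : M) : ℕ∞ :=
  ⨆ l ∈ {l : List M | (∀ x ∈ l, IsMonoidAtom x) ∧ l.prod = a}, (l.length : ℕ∞)

variable (M) in
/-- `M` is generated by its atoms and `‖a‖ < ∞` for every `a`. -/
def IsAtomicMonoid : Prop :=
  Submonoid.closure {a : M | IsMonoidAtom a} = ⊤ ∧ ∀ a : M, atomNorm a < ⊤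

/-- `a ≤_L b`: `a` is a left divisor of `b`. -/
def LeL (a b : M) : Prop := ∃ c : M, a * c = b

/-- `a ≤_R b`: `a` is a right divisor of `b`. -/
def LeR (a b : M) : Prop := ∃ c : M, c * a = b

/-- Any two elements have a greatest lower bound and a least upper bound for the relation `r`. -/
def HasMeetsAndJoins {α : Type*} (r : α → α → Prop) : Prop :=
  ∀ a b : α,
    (∃ m, r m a ∧ r m b ∧ ∀ c, r c a → r c b → r c m) ∧
    (∃ j, r a j ∧ r b j ∧ ∀ c, r a c → r b c → r j c)

/-- `Δ` is a Garside element: its left and right divisors coincide and generate `M`. -/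
structure IsGarsideElement (Δ : M) : Prop where
  divisors_eq : {b : M | LeL b Δ} = {b : M | LeR b Δ}
  closure_eq_top : Submonoid.closure {b : M | LeL b Δ} = ⊤

variable (M) in
/-- Garside monoids. That `≤_L` and `≤_R` are partial orders follows from atomicity
together with cancellation. -/
structure IsGarsideMonoid : Prop where
  atomic : IsAtomicMonoid M
  fg : Monoid.FG M
  cancel : IsCancelMul M
  lattice_left : HasMeetsAndJoins (LeL : M → M → Prop)
  lattice_right : HasMeetsAndJoins (LeR : M → M → Prop)
  exists_garside : ∃ Δ : M, IsGarsideElement Δ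

end Monoid

section Words

variable {G : Type*} [Group G]

/-- `|g|_X`: the length of a shortest word in the alphabet `X` that represents `g`
(the empty word represents `1`). -/
noncomputable def wordLength (X : Set G) (g : G) : ℕ :=
  sInf {n : ℕ | ∃ l : List G, (∀ x ∈ l, x ∈ X) ∧ l.prod = g ∧ l.length = n}

/-- `t_X(g) = lim |g ^ n|_X / n`. -/
noncomputable def translationNumber (X : Set G) (g : G) : ℝ :=
  limUnder atTop (fun n : ℕ => (wordLength X (g ^ n) : ℝ) / n)

end Words

section Group

variable {M G : Type*} [Monoid M] [Group G]

/-- `G` is the group of fractions of the cancellative monoid `M`, with `ι` the canonical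
embedding. -/
structure IsGroupOfFractions (ι : M →* G) : Prop where
  injective : Function.Injective ι
  exists_fraction : ∀ g : G, ∃ a b : M, g = (ι a)⁻¹ * ι b

/-- The order `≤_L` on the group of fractions: `g * c = h` for some positive element `c`. -/
def GroupLeL (ι : M →* G) (g h : G) : Prop := ∃ c : M, g * ι c = h

/-- `inf(g) = max {r : ℤ | Δ ^ r ≤_L g}`. -/
noncomputable def infOf (ι : M →* G) (Δ : M) (g : G) : ℤ :=
  sSup {r : ℤ | GroupLeL ι (ι Δ ^ r) g}

/-- `sup(g) = min {s : ℤ | g ≤_L Δ ^ s}`. -/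
noncomputable def supOf (ι : M →* G) (Δ : M) (g : G) : ℤ :=
  sInf {s : ℤ | GroupLeL ι g (ι Δ ^ s)}

/-- `inf_s(g)`: the maximum of `inf` on the conjugacy class of `g`. -/
noncomputable def summitInf (ι : M →* G) (Δ : M) (g : G) : ℤ :=
  sSup {r : ℤ | ∃ h : G, IsConj g h ∧ infOf ι Δ h = r}

/-- `sup_s(g)`: the minimum of `sup` on the conjugacy class of `g`. -/
noncomputable def summitSup (ι : M →* G) (Δ : M) (g : G) : ℤ :=
  sInf {s : ℤ | ∃ h : G, IsConj g h ∧ supOf ι Δ h = s}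

/-- The super summit set of `g`. -/
def superSummitSet (ι : M →* G) (Δ : M) (g : G) : Set G :=
  {h : G | IsConj g h ∧ infOf ι Δ h = summitInf ι Δ g ∧ supOf ι Δ h = summitSup ι Δ g}

/-- The set `𝒟` of simple elements, viewed in the group. -/
def simples (ι : M →* G) (Δ : M) : Set G := ι '' {b : M | LeL b Δ}

/-- `|g|_𝒟`: word length with respect to `𝒟 ∪ 𝒟⁻¹`. -/
noncomputable def simpleLength (ι : M →* G) (Δ : M) (g : G) : ℕ :=
  wordLength (simples ι Δ ∪ (simples ι Δ)⁻¹) g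

/-- `t_𝒟(g)`: translation number with respect to `𝒟 ∪ 𝒟⁻¹`. -/
noncomputable def simpleTranslationNumber (ι : M →* G) (Δ : M) (g : G) : ℝ :=
  translationNumber (simples ι Δ ∪ (simples ι Δ)⁻¹) g

end Group

end Garside

/-! Write `P` for the image of `M` in `G`, `D` for the image of Δ, and `g ≤ h` for `g⁻¹ * h ∈ P`.
Splitting `g` at the join of `1` and `g` shows that `|g|` is at most `max(sup g, 0) + max(-inf g,
0)`. Conversely, a word with `p` simple and `q` inverse simple letters represents an element with
`-q ≤ inf` and `sup ≤ p`.

The heart is `exists_conj_atLeast`. The map `φ y = g * y * D ^ (-m)` is an order automorphism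
sending `f i = g ^ i * D ^ (-(i * m))` to `f (i + 1)`. If `n * m ≤ inf (g ^ n)`, then `f 0 ≤ f n`,
so the join `x` of the `f i` with `i < n` satisfies `x ≤ φ x`, that is, `m ≤ inf (x⁻¹ * g * x)`.

Hence on the super summit set `inf (g ^ n) < n * (inf g + 1)` and, applying this to `g⁻¹`, `sup (g ^
n) > n * (sup g - 1)`. Each of the two terms of the length bound loses less than `n`, which gives
the constant 2. The upper bound is subadditivity of length, and the limit is Fekete's lemma. -/

namespace Garside

/-! ### Order and joins in a Garside group -/

section Cone

variable {G : Type*} [Group G]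

/-- The properties of the positive cone `P` of a Garside group with Garside element `D` that
concern the order `g ≤ h ↔ g⁻¹ * h ∈ P`. -/
structure IsGarsideCone (P : Submonoid G) (D : G) : Prop where
  mem : D ∈ P
  conj : ∀ p ∈ P, D * p * D⁻¹ ∈ P
  conj_inv : ∀ p ∈ P, D⁻¹ * p * D ∈ P
  antisymm : ∀ p ∈ P, p⁻¹ ∈ P → p = 1
  absorb : ∀ g : G, ∃ k : ℕ, D ^ k * g ∈ P
  join : ∀ g h : G, ∃ j, g⁻¹ * j ∈ P ∧ h⁻¹ * j ∈ P ∧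
    ∀ c, g⁻¹ * c ∈ P → h⁻¹ * c ∈ P → j⁻¹ * c ∈ P

/-- `D ^ m ≤ g` for the order with positive cone `P`, that is, `m ≤ inf g`.
Correspondingly `AtLeast P D (-s) g⁻¹` says `sup g ≤ s`. -/
def AtLeast (P : Submonoid G) (D : G) (m : ℤ) (g : G) : Prop := g * D ^ (-m) ∈ P

/-- The elements between `1` and `D`. -/
def coneSimples (P : Submonoid G) (D : G) : Set G := {g | g ∈ P ∧ g⁻¹ * D ∈ P}

namespace IsGarsideCone

variable {P : Submonoid G} {D : G}

theorem zpow_conj (h : IsGarsideCone P D) (k : ℤ) {p : G} (hp : p ∈ P) :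
    D ^ k * p * D ^ (-k) ∈ P := by
  induction k with
  | zero => simpa using hp
  | succ k ih =>
    have := h.conj _ ih
    convert this using 1
    group
  | pred k ih =>
    have := h.conj_inv _ ih
    convert this using 1
    group

theorem pow_mem (h : IsGarsideCone P D) {k : ℤ} (hk : 0 ≤ k) : D ^ k ∈ P := by
  lift k to ℕ using hk
  simpa using P.pow_mem h.mem k

theorem atLeast_iff (h : IsGarsideCone P D) {m : ℤ} {g : G} :
    AtLeast P D m g ↔ D ^ (-m) * g ∈ P := by
  constructor
  · intro hg
    convert h.zpow_conj (-m) hg using 1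
    group
  · intro hg
    unfold AtLeast
    convert h.zpow_conj m hg using 1
    group

/-- Moving `D ^ m` past the second factor conjugates it, and conjugation by `D` preserves `P`. -/
theorem atLeast_mul (h : IsGarsideCone P D) {m n : ℤ} {g k : G}
    (hg : AtLeast P D m g) (hk : AtLeast P D n k) : AtLeast P D (m + n) (g * k) := by
  have := P.mul_mem hg (h.zpow_conj m hk)
  unfold AtLeast
  convert this using 1
  group

theorem atLeast_zero_one (P : Submonoid G) (D : G) : AtLeast P D 0 1 := by
  simp [AtLeast]

theorem atLeast_pow (h : IsGarsideCone P D) {m : ℤ} {g : G} (hg : AtLeast P D m g) (n : ℕ) :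
    AtLeast P D (n * m) (g ^ n) := by
  induction n with
  | zero => simpa using atLeast_zero_one P D
  | succ n ih =>
    have := h.atLeast_mul ih hg
    rw [pow_succ]
    convert this using 1
    push_cast
    ring

theorem atLeast_anti (h : IsGarsideCone P D) {m n : ℤ} {g : G} (hmn : m ≤ n)
    (hg : AtLeast P D n g) : AtLeast P D m g := by
  have := P.mul_mem hg (h.pow_mem (sub_nonneg.2 hmn))
  unfold AtLeast
  convert this using 1
  group

theorem exists_atLeast (h : IsGarsideCone P D) (g : G) : ∃ q : ℕ, AtLeast P D (-q) g := by
  obtain ⟨k, hk⟩ := h.absorb g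
  exact ⟨k, h.atLeast_iff.2 (by simpa using hk)⟩

theorem atLeast_le (h : IsGarsideCone P D) (hD : D ≠ 1) {m s : ℤ} {g : G}
    (hm : AtLeast P D m g) (hs : AtLeast P D (-s) g⁻¹) : m ≤ s := by
  by_contra! hlt
  have := h.atLeast_anti (m := 1) (by lia) (h.atLeast_mul hm hs)
  exact hD (h.antisymm D h.mem (by simpa [AtLeast] using this))

/-- The infimum of a conjugate is bounded by the supremum of the element. -/
theorem atLeast_conj_le (h : IsGarsideCone P D) (hD : D ≠ 1) {m s : ℤ} {g x : G}
    (hm : AtLeast P D m (x⁻¹ * g * x)) (hs : AtLeast P D (-s) g⁻¹) : m ≤ s := by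
  obtain ⟨a, ha⟩ := h.exists_atLeast x
  obtain ⟨b, hb⟩ := h.exists_atLeast x⁻¹
  -- Passing between `g ^ n` and its conjugate costs `a + b`, independently of `n`, so large `n`
  -- forces `m ≤ s`.
  have key (n : ℕ) : -(a : ℤ) + n * m + -b ≤ n * s := by
    refine h.atLeast_le hD (g := g ^ n) ?_ ?_
    · have := h.atLeast_mul (h.atLeast_mul ha (h.atLeast_pow hm n)) hb
      have e : x * (x⁻¹ * g * x) ^ n * x⁻¹ = g ^ n := by
        rw [← conj_pow]
        congr 1
        group
      rwa [e] at this
    · have := h.atLeast_pow hs n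
      rwa [inv_pow, mul_neg] at this
  by_contra! hlt
  have := key (a + b + 1)
  push_cast at this
  nlinarith

theorem exists_finite_join (h : IsGarsideCone P D) (f : ℕ → G) (n : ℕ) :
    ∃ x, (∀ i ≤ n, (f i)⁻¹ * x ∈ P) ∧
      ∀ c, (∀ i ≤ n, (f i)⁻¹ * c ∈ P) → x⁻¹ * c ∈ P := by
  induction n with
  | zero =>
    refine ⟨f 0, fun i hi => ?_, fun c hc => hc 0 le_rfl⟩
    obtain rfl : i = 0 := by lia
    simp
  | succ n ih =>
    obtain ⟨y, hy, hy'⟩ := ih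
    obtain ⟨j, hyj, hfj, hj⟩ := h.join y (f (n + 1))
    refine ⟨j, fun i hi => ?_, fun c hc => ?_⟩
    · rcases Nat.le_succ_iff.1 hi with hi | rfl
      · convert P.mul_mem (hy i hi) hyj using 1
        group
      · exact hfj
    · exact hj c (hy' c fun i hi => hc i (by lia)) (hc _ le_rfl)

/-- If `n * m ≤ inf (g ^ n)`, then some conjugate of `g` has infimum at least `m`: conjugate by
the join of the elements `g ^ i * D ^ (-(m * i))` with `i < n`. -/
theorem exists_conj_atLeast (h : IsGarsideCone P D) {n : ℕ} (hn : 1 ≤ n) {m : ℤ} {g : G}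
    (hg : AtLeast P D (n * m) (g ^ n)) : ∃ x, AtLeast P D m (x⁻¹ * g * x) := by
  obtain ⟨n, rfl⟩ := Nat.exists_eq_add_of_le' hn
  let f : ℕ → G := fun i => g ^ i * D ^ (-(i * m))
  have hf (i : ℕ) : f (i + 1) = g * f i * D ^ (-m) := by
    simp only [f, pow_succ', mul_assoc, ← zpow_add]
    congr 3
    push_cast
    ring
  obtain ⟨x, hx, hx'⟩ := h.exists_finite_join f n
  have step (i : ℕ) (hi : i ≤ n) : (f (i + 1))⁻¹ * (g * x * D ^ (-m)) ∈ P := by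
    convert h.zpow_conj m (hx i hi) using 1
    rw [hf]
    group
  refine ⟨x, ?_⟩
  have := hx' (g * x * D ^ (-m)) fun i hi => ?_
  · unfold AtLeast
    convert this using 1
    group
  · rcases i with _ | i
    · have := P.mul_mem hg (step n le_rfl)
      convert this using 1
      simp only [f]
      group
    · exact step i (by lia)

/-- A positive element below `D ^ k` is a product of `k` simple elements; the last factor is
split off by the join of `1` and `a * D⁻¹`. -/
theorem exists_list_of_mem (h : IsGarsideCone P D) (k : ℕ) {a : G} (ha : a ∈ P)
    (hk : AtLeast P D (-k) a⁻¹) :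
    ∃ l : List G, (∀ x ∈ l, x ∈ coneSimples P D) ∧ l.prod = a ∧ l.length = k := by
  induction k generalizing a with
  | zero =>
    refine ⟨[], by simp, ?_, rfl⟩
    exact (h.antisymm a ha (by simpa [AtLeast] using hk)).symm
  | succ k ih =>
    -- Both `a` and `D ^ k` bound `1` and `a * D⁻¹`, so they bound `e`; and `a * D⁻¹ ≤ e` makes the
    -- factor `e⁻¹ * a` simple.
    obtain ⟨e, he, hae, hmin⟩ := h.join 1 (a * D⁻¹)
    have hek : AtLeast P D (-k) e⁻¹ := by
      unfold AtLeast
      rw [neg_neg]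
      refine hmin _ ?_ ?_
      · simpa using P.pow_mem h.mem k
      · have := h.conj _ hk
        convert this using 1
        push_cast
        group
    have hea : e⁻¹ * a ∈ P := by
      refine hmin a (by simpa using ha) ?_
      simpa using h.mem
    have haD : (e⁻¹ * a)⁻¹ * D ∈ P := by
      have := h.conj_inv _ hae
      convert this using 1
      group
    obtain ⟨l, hl, hprod, hlen⟩ := ih (by simpa using he) hek
    refine ⟨l ++ [e⁻¹ * a], ?_, by simp [hprod], by simp [hlen]⟩
    intro x hx
    rcases List.mem_append.1 hx with hx | hx
    · exact hl x hx
    · rw [List.mem_singleton.1 hx]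
      exact ⟨hea, haD⟩

/-- With `j` the join of `1` and `g`, write `g = j * (g⁻¹ * j)⁻¹`. Since `D ^ p` and `g * D ^ q`
both lie above `1` and `g`, minimality of `j` bounds the two positive factors by `D ^ p` and `D ^
q`. -/
theorem exists_word (h : IsGarsideCone P D) {p q : ℕ} {g : G}
    (hq : AtLeast P D (-q) g) (hp : AtLeast P D (-p) g⁻¹) :
    ∃ l : List G, (∀ x ∈ l, x ∈ coneSimples P D ∪ (coneSimples P D)⁻¹) ∧ l.prod = g ∧
      l.length = p + q := by
  obtain ⟨j, h1j, hgj, hmin⟩ := h.join 1 g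
  have hj : AtLeast P D (-p) j⁻¹ := by
    unfold AtLeast
    rw [neg_neg]
    refine hmin _ (by simpa using P.pow_mem h.mem p) ?_
    simpa [AtLeast] using hp
  have hgj' : AtLeast P D (-q) (g⁻¹ * j)⁻¹ := by
    unfold AtLeast
    rw [neg_neg]
    have := hmin (g * D ^ (q : ℤ)) ?_ ?_
    · convert this using 1
      group
    · simpa [AtLeast] using hq
    · simpa using P.pow_mem h.mem q
  obtain ⟨l, hl, hlprod, hllen⟩ := h.exists_list_of_mem p (by simpa using h1j) hj
  obtain ⟨r, hr, hrprod, hrlen⟩ := h.exists_list_of_mem q hgj hgj'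
  refine ⟨l ++ (r.map (·⁻¹)).reverse, ?_, ?_, by simp [hllen, hrlen]⟩
  · intro x hx
    rcases List.mem_append.1 hx with hx | hx
    · exact Or.inl (hl x hx)
    · obtain ⟨y, hy, rfl⟩ := List.mem_map.1 (List.mem_reverse.1 hx)
      exact Or.inr (by simpa using hr y hy)
  · rw [List.prod_append, ← List.prod_inv_reverse, hlprod, hrprod]
    group

/-- A simple letter raises `sup` by at most one and does not lower the bound on `inf`; an inverse
letter does the reverse. -/
theorem atLeast_of_word (h : IsGarsideCone P D) (l : List G)
    (hl : ∀ x ∈ l, x ∈ coneSimples P D ∪ (coneSimples P D)⁻¹) :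
    ∃ p q : ℕ, p + q = l.length ∧ AtLeast P D (-q) l.prod ∧ AtLeast P D (-p) l.prod⁻¹ := by
  induction l with
  | nil => exact ⟨0, 0, rfl, by simp [AtLeast], by simp [AtLeast]⟩
  | cons x l ih =>
    obtain ⟨p, q, hpq, hq, hp⟩ := ih fun y hy => hl y (List.mem_cons_of_mem _ hy)
    rw [List.prod_cons, mul_inv_rev, List.length_cons]
    rcases hl x List.mem_cons_self with ⟨hx, hxD⟩ | ⟨hx, hxD⟩
    · refine ⟨p + 1, q, by lia, ?_, ?_⟩
      · simpa using h.atLeast_mul (m := 0) (g := x) (by simpa [AtLeast] using hx) hq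
      · have := h.atLeast_mul hp (n := -1) (k := x⁻¹) (by simpa [AtLeast] using hxD)
        convert this using 1
        push_cast
        ring
    · refine ⟨p, q + 1, by lia, ?_, ?_⟩
      · have := h.atLeast_mul (m := -1) (g := x) (by simpa [AtLeast] using hxD) hq
        convert this using 1
        push_cast
        ring
      · simpa using h.atLeast_mul hp (n := 0) (k := x⁻¹) (by simpa [AtLeast] using hx)

end IsGarsideCone

end Cone

/-! ### Word length and translation numbers -/

section WordLength

variable {G : Type*} [Group G] {X : Set G}

theorem wordLength_le {l : List G} (hl : ∀ x ∈ l, x ∈ X) : wordLength X l.prod ≤ l.length :=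
  Nat.sInf_le ⟨l, hl, rfl, rfl⟩

/-- Generation by `X` is essential: on an element without words, `sInf ∅ = 0` would be attained by
no list. -/
theorem exists_list_length_eq_wordLength
    (hX : ∀ g : G, ∃ l : List G, (∀ x ∈ l, x ∈ X) ∧ l.prod = g) (g : G) :
    ∃ l : List G, (∀ x ∈ l, x ∈ X) ∧ l.prod = g ∧ l.length = wordLength X g := by
  obtain ⟨l, hl, hg⟩ := hX g
  exact Nat.sInf_mem
    (s := {n : ℕ | ∃ l : List G, (∀ x ∈ l, x ∈ X) ∧ l.prod = g ∧ l.length = n})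
    ⟨_, l, hl, hg, rfl⟩

theorem wordLength_mul_le
    (hX : ∀ g : G, ∃ l : List G, (∀ x ∈ l, x ∈ X) ∧ l.prod = g) (g h : G) :
    wordLength X (g * h) ≤ wordLength X g + wordLength X h := by
  obtain ⟨l, hl, hlg, hll⟩ := exists_list_length_eq_wordLength hX g
  obtain ⟨r, hr, hrh, hrl⟩ := exists_list_length_eq_wordLength hX h
  rw [← hll, ← hrl, ← List.length_append, ← hlg, ← hrh, ← List.prod_append]
  refine wordLength_le fun x hx => ?_
  rcases List.mem_append.1 hx with hx | hx
  exacts [hl x hx, hr x hx]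

theorem wordLength_one (X : Set G) : wordLength X 1 = 0 :=
  Nat.le_zero.1 (wordLength_le (l := []) (by simp))

theorem wordLength_pow_le
    (hX : ∀ g : G, ∃ l : List G, (∀ x ∈ l, x ∈ X) ∧ l.prod = g) (g : G) (n : ℕ) :
    wordLength X (g ^ n) ≤ n * wordLength X g := by
  induction n with
  | zero => simp [wordLength_one]
  | succ n ih =>
    rw [pow_succ, Nat.succ_mul]
    exact (wordLength_mul_le hX _ _).trans (by gcongr)

/-- Fekete's lemma: the lengths of the powers are subadditive and bounded below. -/
theorem tendsto_translationNumber
    (hX : ∀ g : G, ∃ l : List G, (∀ x ∈ l, x ∈ X) ∧ l.prod = g) (g : G) :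
    Tendsto (fun n : ℕ => (wordLength X (g ^ n) : ℝ) / n) atTop
      (𝓝 (translationNumber X g)) := by
  have hsub : Subadditive fun n : ℕ => (wordLength X (g ^ n) : ℝ) := fun m n => by
    beta_reduce
    rw [pow_add]
    exact_mod_cast wordLength_mul_le hX _ _
  have := hsub.tendsto_lim ⟨0, by rintro _ ⟨n, rfl⟩; positivity⟩
  unfold translationNumber
  rwa [this.limUnder_eq]

end WordLength

/-! ### Units of atomic monoids -/

section Monoid

variable {M : Type*} [Monoid M]

/-- An atomic monoid has no nontrivial units: powers of a nonempty expression of `1` would be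
arbitrarily long expressions of `1`. -/
theorem IsAtomicMonoid.eq_one_of_mul_eq_one (hM : IsAtomicMonoid M) {a b : M}
    (hab : a * b = 1) : a = 1 := by
  have hgen (a : M) : ∃ l : List M, (∀ x ∈ l, IsMonoidAtom x) ∧ l.prod = a :=
    Submonoid.exists_list_of_mem_closure (hM.1 ▸ Submonoid.mem_top a)
  obtain ⟨l, hl, rfl⟩ := hgen a
  obtain ⟨r, hr, rfl⟩ := hgen b
  by_contra hne
  have hpos : 1 ≤ l.length := by
    rcases l with _ | ⟨x, l⟩
    · simp at hne
    · simp
  refine (hM.2 1).ne (ENat.eq_top_iff_forall_ge.2 fun n => ?_)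
  have hmem : (List.replicate n (l ++ r)).flatten ∈
      {l : List M | (∀ x ∈ l, IsMonoidAtom x) ∧ l.prod = 1} := by
    refine ⟨fun x hx => ?_, by simp [List.prod_flatten, hab]⟩
    obtain ⟨s, hs, hxs⟩ := List.mem_flatten.1 hx
    rw [List.eq_of_mem_replicate hs] at hxs
    rcases List.mem_append.1 hxs with hx | hx
    exacts [hl x hx, hr x hx]
  refine le_trans ?_ (le_biSup (fun l : List M => (l.length : ℕ∞)) hmem)
  simp only [List.length_flatten, List.map_replicate, List.sum_replicate, List.length_append]
  norm_cast
  exact Nat.le_mul_of_pos_right n (by lia)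

end Monoid

/-! ### The positive cone of a Garside group -/

section Group

variable {M G : Type*} [Monoid M] [Group G] {Δ : M} {ι : M →* G}

theorem groupLeL_iff {g h : G} : GroupLeL ι g h ↔ g⁻¹ * h ∈ MonoidHom.mrange ι := by
  simp only [GroupLeL, MonoidHom.mem_mrange, eq_inv_mul_iff_mul_eq]

theorem inv_mul_mem_mrange_iff (hι : IsGroupOfFractions ι) {a b : M} :
    (ι a)⁻¹ * ι b ∈ MonoidHom.mrange ι ↔ LeL a b := by
  simp only [← groupLeL_iff, GroupLeL, LeL, ← map_mul, hι.injective.eq_iff]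

theorem IsGarsideElement.isGarsideCone (hM : IsGarsideMonoid M) (hΔ : IsGarsideElement Δ)
    (hι : IsGroupOfFractions ι) : IsGarsideCone (MonoidHom.mrange ι) (ι Δ) := by
  have hdiv (b : M) : LeL b Δ ↔ LeR b Δ := Set.ext_iff.1 hΔ.divisors_eq b
  have hind {Q : M → Prop} (hs : ∀ b, LeL b Δ → Q b) (h1 : Q 1)
      (hmul : ∀ a b, Q a → Q b → Q (a * b)) (a : M) : Q a :=
    Submonoid.closure_induction (motive := fun x _ => Q x) (fun x hx => hs x hx) h1
      (fun x y _ _ => hmul x y) (hΔ.closure_eq_top ▸ Submonoid.mem_top a)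
  have hconj (a : M) : ι Δ * ι a * (ι Δ)⁻¹ ∈ MonoidHom.mrange ι := by
    refine hind (Q := fun a => ι Δ * ι a * (ι Δ)⁻¹ ∈ MonoidHom.mrange ι) ?_ ?_ ?_ a
    · intro s hs
      -- From `Δ = t * s` and `Δ = u * t` it follows that `Δ * s = u * t * s = u * Δ`.
      obtain ⟨t, ht⟩ := (hdiv s).1 hs
      obtain ⟨u, hu⟩ := (hdiv t).1 ⟨s, ht⟩
      refine ⟨u, ?_⟩
      rw [eq_mul_inv_iff_mul_eq, ← map_mul, ← map_mul]
      nth_rw 1 [← ht]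
      rw [← mul_assoc, hu]
    · simp
    · intro a b ha hb
      convert Submonoid.mul_mem _ ha hb using 1
      rw [map_mul]
      group
  have hconj' (a : M) : (ι Δ)⁻¹ * ι a * ι Δ ∈ MonoidHom.mrange ι := by
    refine hind (Q := fun a => (ι Δ)⁻¹ * ι a * ι Δ ∈ MonoidHom.mrange ι) ?_ ?_ ?_ a
    · intro s hs
      obtain ⟨t, ht⟩ := hs
      obtain ⟨u, hu⟩ := (hdiv t).2 ⟨s, ht⟩
      refine ⟨u, ?_⟩
      rw [mul_assoc, eq_inv_mul_iff_mul_eq, ← map_mul, ← map_mul]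
      nth_rw 1 [← ht]
      rw [mul_assoc, hu]
    · simp
    · intro a b ha hb
      convert Submonoid.mul_mem _ ha hb using 1
      rw [map_mul]
      group
  have habs (a : M) : ∃ k : ℕ, ι Δ ^ k * (ι a)⁻¹ ∈ MonoidHom.mrange ι := by
    refine hind (Q := fun a => ∃ k : ℕ, ι Δ ^ k * (ι a)⁻¹ ∈ MonoidHom.mrange ι) ?_ ?_ ?_ a
    · intro s hs
      obtain ⟨t, ht⟩ := (hdiv s).1 hs
      exact ⟨1, t, by rw [← ht]; simp⟩
    · exact ⟨0, by simp⟩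
    · rintro a b ⟨k, hk⟩ ⟨l, hl⟩
      have hpow (n : ℕ) : ∀ p ∈ MonoidHom.mrange ι,
          ι Δ ^ n * p * (ι Δ ^ n)⁻¹ ∈ MonoidHom.mrange ι := by
        induction n with
        | zero => simp
        | succ n ih =>
          rintro p ⟨c, rfl⟩
          convert ih _ (hconj c) using 1
          rw [pow_succ]
          group
      refine ⟨k + l, ?_⟩
      convert Submonoid.mul_mem _ (hpow k _ hl) hk using 1
      rw [pow_add, map_mul]
      group
  have habs' (g : G) : ∃ k : ℕ, ι Δ ^ k * g ∈ MonoidHom.mrange ι := by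
    obtain ⟨a, b, rfl⟩ := hι.exists_fraction g
    obtain ⟨k, hk⟩ := habs a
    refine ⟨k, ?_⟩
    rw [← mul_assoc]
    exact Submonoid.mul_mem _ hk ⟨b, rfl⟩
  refine ⟨⟨Δ, rfl⟩, ?_, ?_, ?_, habs', ?_⟩
  · rintro _ ⟨a, rfl⟩
    exact hconj a
  · rintro _ ⟨a, rfl⟩
    exact hconj' a
  · rintro _ ⟨a, rfl⟩ ⟨b, hb⟩
    rw [hM.atomic.eq_one_of_mul_eq_one (a := a) (b := b), map_one]
    apply hι.injective
    rw [map_mul, hb, mul_inv_cancel, map_one]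
  · intro g h
    -- Left translation by `Δ ^ (k + l)` preserves the order and makes both elements positive, so
    -- the join can be taken in `M` and translated back.
    obtain ⟨k, hk⟩ := habs' g
    obtain ⟨l, hl⟩ := habs' h
    have hD (n : ℕ) : ι Δ ^ n ∈ MonoidHom.mrange ι := ⟨Δ ^ n, map_pow _ _ _⟩
    obtain ⟨u, hu⟩ : ι Δ ^ (k + l) * g ∈ MonoidHom.mrange ι := by
      rw [add_comm, pow_add, mul_assoc]
      exact Submonoid.mul_mem _ (hD l) hk
    obtain ⟨v, hv⟩ : ι Δ ^ (k + l) * h ∈ MonoidHom.mrange ι := by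
      rw [pow_add, mul_assoc]
      exact Submonoid.mul_mem _ (hD k) hl
    obtain rfl : g = (ι Δ ^ (k + l))⁻¹ * ι u := by rw [hu]; group
    obtain rfl : h = (ι Δ ^ (k + l))⁻¹ * ι v := by rw [hv]; group
    obtain ⟨j, huj, hvj, hj⟩ := (hM.lattice_left u v).2
    refine ⟨(ι Δ ^ (k + l))⁻¹ * ι j, ?_, ?_, ?_⟩
    · convert (inv_mul_mem_mrange_iff hι).2 huj using 1
      group
    · convert (inv_mul_mem_mrange_iff hι).2 hvj using 1
      group
    · intro c huc hvc
      obtain ⟨w, hw⟩ : ι Δ ^ (k + l) * c ∈ MonoidHom.mrange ι := by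
        convert Submonoid.mul_mem _ (⟨u, rfl⟩ : ι u ∈ MonoidHom.mrange ι) huc using 1
        group
      obtain rfl : c = (ι Δ ^ (k + l))⁻¹ * ι w := by rw [hw]; group
      have cancel (x : M) : ((ι Δ ^ (k + l))⁻¹ * ι x)⁻¹ * ((ι Δ ^ (k + l))⁻¹ * ι w) =
          (ι x)⁻¹ * ι w := by group
      rw [cancel, inv_mul_mem_mrange_iff hι] at huc hvc ⊢
      exact hj w huc hvc

theorem simples_eq_coneSimples (hι : IsGroupOfFractions ι) (Δ : M) :
    simples ι Δ = coneSimples (MonoidHom.mrange ι) (ι Δ) := by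
  ext g
  constructor
  · rintro ⟨b, hb, rfl⟩
    exact ⟨⟨b, rfl⟩, (inv_mul_mem_mrange_iff hι).2 hb⟩
  · rintro ⟨⟨b, rfl⟩, hb⟩
    exact ⟨b, (inv_mul_mem_mrange_iff hι).1 hb, rfl⟩

theorem subsingleton_of_map_eq_one (hM : IsGarsideMonoid M) (hΔ : IsGarsideElement Δ)
    (hι : IsGroupOfFractions ι) (h1 : ι Δ = 1) : Subsingleton G := by
  obtain rfl : Δ = 1 := hι.injective (by rw [h1, map_one])
  have hs : {b : M | LeL b 1} ⊆ ((⊥ : Submonoid M) : Set M) := by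
    rintro b ⟨c, hc⟩
    exact hM.atomic.eq_one_of_mul_eq_one hc
  have hbot (a : M) : a = 1 := by
    have := Submonoid.closure_le.2 hs
    rw [hΔ.closure_eq_top] at this
    exact Submonoid.mem_bot.1 (this (Submonoid.mem_top a))
  refine subsingleton_of_forall_eq 1 fun g => ?_
  obtain ⟨a, b, rfl⟩ := hι.exists_fraction g
  simp [hbot a, hbot b]

/-! ### Infimum, supremum and their summit values -/

theorem isGreatest_infOf (hC : IsGarsideCone (MonoidHom.mrange ι) (ι Δ)) (hD : ι Δ ≠ 1) (g : G) :
    IsGreatest {r : ℤ | AtLeast (MonoidHom.mrange ι) (ι Δ) r g} (infOf ι Δ g) := by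
  have hset : {r : ℤ | GroupLeL ι (ι Δ ^ r) g} =
      {r : ℤ | AtLeast (MonoidHom.mrange ι) (ι Δ) r g} := by
    ext r
    rw [Set.mem_ofPred_eq, Set.mem_ofPred_eq, groupLeL_iff, hC.atLeast_iff, zpow_neg]
  obtain ⟨q, hq⟩ := hC.exists_atLeast g
  obtain ⟨p, hp⟩ := hC.exists_atLeast g⁻¹
  have hbdd : BddAbove {r : ℤ | AtLeast (MonoidHom.mrange ι) (ι Δ) r g} :=
    ⟨p, fun r hr => hC.atLeast_le hD hr hp⟩
  unfold infOf
  rw [hset]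
  exact ⟨Int.csSup_mem ⟨_, hq⟩ hbdd, fun r hr => le_csSup hbdd hr⟩

theorem supOf_eq_neg_infOf_inv (hC : IsGarsideCone (MonoidHom.mrange ι) (ι Δ)) (hD : ι Δ ≠ 1)
    (g : G) : supOf ι Δ g = -infOf ι Δ g⁻¹ := by
  have hset : {s : ℤ | GroupLeL ι g (ι Δ ^ s)} =
      {s : ℤ | AtLeast (MonoidHom.mrange ι) (ι Δ) (-s) g⁻¹} := by
    ext s
    simp [groupLeL_iff, AtLeast]
  have h := isGreatest_infOf hC hD g⁻¹
  unfold supOf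
  rw [hset]
  refine IsLeast.csInf_eq ⟨?_, fun s hs => ?_⟩
  · simpa using h.1
  · exact neg_le.1 (h.2 hs)

/-- This bounds the sets defining `summitInf` and `summitSup`, so that `sSup` and `sInf` do not take
default values. -/
theorem infOf_conj_le (hC : IsGarsideCone (MonoidHom.mrange ι) (ι Δ)) (hD : ι Δ ≠ 1)
    (g x : G) : infOf ι Δ (x⁻¹ * g * x) ≤ supOf ι Δ g := by
  refine hC.atLeast_conj_le hD (isGreatest_infOf hC hD _).1 ?_
  rw [supOf_eq_neg_infOf_inv hC hD, neg_neg]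
  exact (isGreatest_infOf hC hD _).1

theorem isConj_inv_mul_mul (g x : G) : IsConj g (x⁻¹ * g * x) :=
  isConj_iff.2 ⟨x⁻¹, by simp⟩

theorem exists_of_isConj {g h : G} (hgh : IsConj g h) : ∃ x, h = x⁻¹ * g * x := by
  obtain ⟨c, rfl⟩ := isConj_iff.1 hgh
  exact ⟨c⁻¹, by simp⟩

theorem infOf_conj_le_summitInf (hC : IsGarsideCone (MonoidHom.mrange ι) (ι Δ)) (hD : ι Δ ≠ 1)
    (g x : G) : infOf ι Δ (x⁻¹ * g * x) ≤ summitInf ι Δ g := by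
  refine le_csSup ⟨supOf ι Δ g, ?_⟩ ⟨_, isConj_inv_mul_mul g x, rfl⟩
  rintro _ ⟨h, hgh, rfl⟩
  obtain ⟨y, rfl⟩ := exists_of_isConj hgh
  exact infOf_conj_le hC hD g y

theorem summitSup_le_supOf_conj (hC : IsGarsideCone (MonoidHom.mrange ι) (ι Δ)) (hD : ι Δ ≠ 1)
    (g x : G) : summitSup ι Δ g ≤ supOf ι Δ (x⁻¹ * g * x) := by
  refine csInf_le ⟨infOf ι Δ g, ?_⟩ ⟨_, isConj_inv_mul_mul g x, rfl⟩
  rintro _ ⟨h, hgh, rfl⟩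
  obtain ⟨y, rfl⟩ := exists_of_isConj hgh.symm
  exact infOf_conj_le hC hD h y

/-- If `inf g` is maximal in the conjugacy class, then `inf (g ^ n) < n * (inf g + 1)`. -/
theorem lt_of_atLeast_pow (hC : IsGarsideCone (MonoidHom.mrange ι) (ι Δ)) (hD : ι Δ ≠ 1)
    {g : G} (hg : ∀ x, infOf ι Δ (x⁻¹ * g * x) ≤ infOf ι Δ g) {n : ℕ} (hn : 1 ≤ n) {m : ℤ}
    (hm : AtLeast (MonoidHom.mrange ι) (ι Δ) m (g ^ n)) : m < n * (infOf ι Δ g + 1) := by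
  by_contra! hle
  obtain ⟨x, hx⟩ := hC.exists_conj_atLeast hn (hC.atLeast_anti hle hm)
  have := (isGreatest_infOf hC hD _).2 hx
  have := hg x
  lia

/-! ### Simple length against infimum and supremum -/

theorem exists_simple_word (hC : IsGarsideCone (MonoidHom.mrange ι) (ι Δ))
    (hι : IsGroupOfFractions ι) (g : G) :
    ∃ l : List G, (∀ x ∈ l, x ∈ simples ι Δ ∪ (simples ι Δ)⁻¹) ∧ l.prod = g := by
  obtain ⟨q, hq⟩ := hC.exists_atLeast g
  obtain ⟨p, hp⟩ := hC.exists_atLeast g⁻¹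
  obtain ⟨l, hl, hg, -⟩ := hC.exists_word hq hp
  exact ⟨l, by rwa [simples_eq_coneSimples hι], hg⟩

theorem simpleLength_le (hC : IsGarsideCone (MonoidHom.mrange ι) (ι Δ)) (hD : ι Δ ≠ 1)
    (hι : IsGroupOfFractions ι) (g : G) :
    (simpleLength ι Δ g : ℤ) ≤ max (supOf ι Δ g) 0 + max (-infOf ι Δ g) 0 := by
  have hp : AtLeast (MonoidHom.mrange ι) (ι Δ) (-((supOf ι Δ g).toNat : ℤ)) g⁻¹ := by
    refine hC.atLeast_anti ?_ (isGreatest_infOf hC hD _).1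
    have := supOf_eq_neg_infOf_inv hC hD g
    lia
  have hq : AtLeast (MonoidHom.mrange ι) (ι Δ) (-((-infOf ι Δ g).toNat : ℤ)) g :=
    hC.atLeast_anti (by lia) (isGreatest_infOf hC hD _).1
  obtain ⟨l, hl, rfl, hlen⟩ := hC.exists_word hq hp
  rw [← simples_eq_coneSimples hι] at hl
  have := wordLength_le hl
  unfold simpleLength
  lia

theorem lt_simpleLength_pow (hC : IsGarsideCone (MonoidHom.mrange ι) (ι Δ)) (hD : ι Δ ≠ 1)
    (hι : IsGroupOfFractions ι) {g : G} (hg : g ∈ superSummitSet ι Δ g) {n : ℕ} (hn : 1 ≤ n) :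
    (n * simpleLength ι Δ g : ℤ) < simpleLength ι Δ (g ^ n) + 2 * n := by
  obtain ⟨-, hinf, hsup⟩ := hg
  obtain ⟨l, hl, hlg, hlen⟩ :=
    exists_list_length_eq_wordLength (exists_simple_word hC hι) (g ^ n)
  rw [simples_eq_coneSimples hι] at hl
  obtain ⟨p, q, hpq, hq, hp⟩ := hC.atLeast_of_word l hl
  rw [hlg] at hq hp
  have hq' := lt_of_atLeast_pow hC hD
    (fun x => (infOf_conj_le_summitInf hC hD g x).trans hinf.ge) hn hq
  rw [← inv_pow] at hp
  -- Minimality of `sup g` is maximality of `inf g⁻¹`, so the estimate for `inf` applies to `g⁻¹`.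
  have hp' := lt_of_atLeast_pow hC hD (fun x => by
    have := hsup.le.trans (summitSup_le_supOf_conj hC hD g x)
    rw [supOf_eq_neg_infOf_inv hC hD, supOf_eq_neg_infOf_inv hC hD, neg_le_neg_iff] at this
    simpa [mul_assoc] using this) hn hp
  rw [← neg_neg (infOf ι Δ g⁻¹), ← supOf_eq_neg_infOf_inv hC hD] at hp'
  have hle := simpleLength_le hC hD hι g
  have hlen' : simpleLength ι Δ (g ^ n) = p + q := by rw [hpq, hlen]; rfl
  rw [hlen']
  have hn' : (1 : ℤ) ≤ n := by exact_mod_cast hn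
  refine (mul_le_mul_of_nonneg_left hle (by lia)).trans_lt ?_
  push_cast
  -- Now `n * sup g < p + n` and `n * (-inf g) < q + n`; a truncated term is `0`, which is still
  -- below `p + n` or `q + n` because `1 ≤ n`.
  rcases max_cases (supOf ι Δ g) 0 with ⟨h1, _⟩ | ⟨h1, _⟩ <;>
  rcases max_cases (-infOf ι Δ g) 0 with ⟨h2, _⟩ | ⟨h2, _⟩ <;>
  rw [h1, h2] <;> linarith

end Group

end Garside

theorem theorem7p1 {M G : Type*} [Monoid M] [Group G]
    (hM : Garside.IsGarsideMonoid M)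
    (Δ : M) (hΔ : Garside.IsGarsideElement Δ)
    (ι : M →* G) (hι : Garside.IsGroupOfFractions ι)
    (g : G) (hg : g ∈ Garside.superSummitSet ι Δ g) :
    (∀ n : ℕ, 1 ≤ n →
      (Garside.simpleLength ι Δ g : ℝ) - 2 < (Garside.simpleLength ι Δ (g ^ n) : ℝ) / n ∧
      (Garside.simpleLength ι Δ (g ^ n) : ℝ) / n ≤ (Garside.simpleLength ι Δ g : ℝ)) ∧
    Tendsto (fun n : ℕ => (Garside.simpleLength ι Δ (g ^ n) : ℝ) / n) atTop
      (𝓝 (Garside.simpleTranslationNumber ι Δ g)) ∧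
    (Garside.simpleLength ι Δ g : ℝ) - 2 ≤ Garside.simpleTranslationNumber ι Δ g ∧
    Garside.simpleTranslationNumber ι Δ g ≤ (Garside.simpleLength ι Δ g : ℝ) := by
  have hC := hΔ.isGarsideCone hM hι
  have hword := Garside.exists_simple_word hC hι
  have hbound : ∀ n : ℕ, 1 ≤ n →
      (Garside.simpleLength ι Δ g : ℝ) - 2 < (Garside.simpleLength ι Δ (g ^ n) : ℝ) / n ∧
      (Garside.simpleLength ι Δ (g ^ n) : ℝ) / n ≤ (Garside.simpleLength ι Δ g : ℝ) := by
    intro n hn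
    have hn0 : (0 : ℝ) < n := by exact_mod_cast hn
    constructor
    -- If Δ is trivial, all its powers coincide and `inf`, `sup` carry no information; but then `G`
    -- is trivial and the bound reads `-2 < 0`.
    · by_cases hD : ι Δ = 1
      · have := Garside.subsingleton_of_map_eq_one hM hΔ hι hD
        have h0 : Garside.simpleLength ι Δ g = 0 := by
          rw [Subsingleton.elim g 1]
          exact Garside.wordLength_one _
        rw [h0]
        have : (0 : ℝ) ≤ (Garside.simpleLength ι Δ (g ^ n) : ℝ) / n := by positivity
        push_cast
        linarith
      · rw [lt_div_iff₀ hn0]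
        have : ((n * Garside.simpleLength ι Δ g : ℤ) : ℝ) <
            ((Garside.simpleLength ι Δ (g ^ n) + 2 * n : ℤ) : ℝ) :=
          Int.cast_lt.2 (Garside.lt_simpleLength_pow hC hD hι hg hn)
        push_cast at this
        linarith
    · rw [div_le_iff₀' hn0]
      exact_mod_cast Garside.wordLength_pow_le hword g n
  have hlim : Tendsto (fun n : ℕ => (Garside.simpleLength ι Δ (g ^ n) : ℝ) / n) atTop
      (𝓝 (Garside.simpleTranslationNumber ι Δ g)) :=
    Garside.tendsto_translationNumber hword g
  refine ⟨hbound, hlim, ge_of_tendsto hlim ?_, le_of_tendsto hlim ?_⟩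
  · filter_upwards [eventually_ge_atTop 1] with n hn using (hbound n hn).1.le
  · filter_upwards [eventually_ge_atTop 1] with n hn using (hbound n hn).2
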